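/- Let $S\subset\mathbb R^d$ be closed with $0\in S$ and $\overline{S^{\rm int}}=S$, let $dx$ denote Lebesgue measure on $S$, and let $\mathfrak M$ be the space of configurations $\xi=\sum_i\delta_{x_i}$ on $S$ with $\xi(K)<\infty$ for all compact $K\subset S$, with the vague topology. Put $U_r=\{x\in S:|x|\le r\}$, $\mathfrak M_{r,n}=\{\xi\in\mathfrak M:\xi(U_r)=n\}$, $\pi_r(\xi)=\xi(\cdot\cap U_r)$ and $\pi_r^c(\xi)=\xi(\cdot\setminus U_r)$. For $x\in\xi$ and $y\in S$ let $\xi^{xy}=\xi-\delta_x+\delta_y$. Let $\nu(\xi,x;y)\ge 0$ be a measurable function on $\mathfrak M\times S\times S$ with $\int_S(1\wedge|y-x|^2)\,\nu(\xi,x;y)\,dy<\infty$ for all $\xi\in\mathfrak M$, $x\in\xi$. Let $\mathfrak D_\circ$ be the set of functions $f:\mathfrak M\to\mathbb R$ that are $\sigma[\pi_r]$-measurable for some $r\in\mathbb N$ and such that, for all $r,n,\xi$, the function $(x_1,\dots,x_n)\mapsto f\big(\sum_i\delta_{x_i}+\pi_r^c(\xi)\big)$ is smooth on $U_r^n$.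 For a probability measure $\mu$ on $\mathfrak M$ set $$\mathfrak E(f,g)=\frac12\int_{\mathfrak M}\mu(d\xi)\int_S\xi(dx)\int_S\big(f(\xi^{xy})-f(\xi)\big)\big(g(\xi^{xy})-g(\xi)\big)\,\nu(\xi,x;y)\,dy,\qquad \mathfrak D_\infty=\{f\in\mathfrak D_\circ\cap L^2(\mathfrak M,\mu):\mathfrak E(f,f)<\infty\}.$$ Let $\Phi:S\to\mathbb R\cup\{\infty\}$ and $\Psi:S\times S\to\mathbb R\cup\{\infty\}$ be Borel measurable with $\Psi(x,y)=\Psi(y,x)$ and $\Phi<\infty$ a.e., and let $\mathcal H_r(x_1,\dots,x_n)=\sum_{x_i\in U_r}\Phi(x_i)+\sum_{i<j,\;x_i,x_j\in U_r}\Psi(x_i,x_j)$. The measure $\mu$ is called $(\Phi,\Psi)$-quasi-Gibbs if there are natural numbers $b_1<b_2<\cdots$ and finite measures $\mu_{r,k}^n$ on $\mathfrak M$ such that, for all $r,n$, $\mu_{r,k}^n\le\mu_{r,k+1}^n$ for all $k$, $\mu_{r,k}^n\to\mu(\cdot\cap\mathfrak M_{b_r,n})$ weakly as $k\to\infty$,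 and for all $k$ and $\mu_{r,k}^n$-a.e. $\xi$ there is a constant $C\in(0,\infty)$ depending only on $r,n,k,\pi_{b_r}^c(\xi)$ with $$C^{-1}e^{-\mathcal H_{b_r}}\mathbf 1_{\mathfrak M_{b_r,n}}\,d\Lambda\;\le\;\mu_{r,k}^n\big(\pi_{b_r}\in\cdot\,\big|\,\pi_{b_r}^c(\xi)\big)\;\le\;C\,e^{-\mathcal H_{b_r}}\mathbf 1_{\mathfrak M_{b_r,n}}\,d\Lambda$$ as measures on configurations in $U_{b_r}$, where $\Lambda$ is (the law on $U_{b_r}$ of) the Poisson random point field on $S$ with Lebesgue intensity. Theorem. Suppose that $\mu$ is a $(\Phi,\Psi)$-quasi-Gibbs measure, and that there are upper semi-continuous $\Phi_0:S\to\mathbb R\cup\{\infty\}$, $\Psi_0:S\times S\to\mathbb R\cup\{\infty\}$ and positive constants $C_3,C_4$ with $C_3^{-1}\Phi_0\le\Phi\le C_3\Phi_0$ on $S$ and $C_4^{-1}\Psi_0\le\Psi\le C_4\Psi_0$ on $S\times S$. Suppose also that particles do not jump to places where their interaction with another particle is infinite: for $\mu$-a.e. $\xi$ and all $x\in\xi$,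 one has $\nu(\xi,x;y)=0$ for a.e. $y\in S$ with $\Psi(y,z)=\infty$ for some $z\in\xi\setminus x:=\xi-\delta_x$ (this holds automatically if $\Psi<\infty$ a.e. on $S\times S$). Then $(\mathfrak E,\mathfrak D_\infty)$ is closable on $L^2(\mathfrak M,\mu)$: if $f_p\in\mathfrak D_\infty$, $\mathfrak E(f_p-f_q,f_p-f_q)\to0$ as $p,q\to\infty$ and $\|f_p\|_{L^2(\mu)}\to0$, then $\mathfrak E(f_p,f_p)\to0$. -/

import Mathlib

open MeasureTheory ProbabilityTheory Filter Topology
open scoped ENNReal NNReal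

noncomputable section

/-- A configuration `ξ = ∑ᵢ δ_{xᵢ}` on `S` (points may be repeated) with finitely many particles in
every compact subset of `S`. It is recorded through its multiplicities `ξ({x})`. -/
@[ext]
structure PointConfig {d : ℕ} (S : Set (EuclideanSpace ℝ (Fin d))) where
  /-- the number of particles sitting at a point -/
  mult : S → ℕ
  finite_inter : ∀ K : Set S, IsCompact K → (K ∩ Function.support mult).Finite

namespace PointConfig

variable {d : ℕ} {S : Set (EuclideanSpace ℝ (Fin d))}

/-- The configuration as a measure, `∑ₓ ξ({x}) δₓ`. -/
def toMeasure (ξ : PointConfig S) : Measure S :=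
  Measure.sum fun x : S => (ξ.mult x : ℝ≥0∞) • Measure.dirac x

/-- The vague topology: the coarsest one for which `ξ ↦ ∫ φ dξ` is continuous for every continuous
compactly supported `φ`. -/
instance : TopologicalSpace (PointConfig S) :=
  ⨅ φ : CompactlySupportedContinuousMap S ℝ,
    TopologicalSpace.induced (fun ξ : PointConfig S => ∫ x, φ x ∂ξ.toMeasure) inferInstance

/-- The `σ`-algebra generated by the particle numbers `ξ ↦ ξ(A)`, `A` Borel; it is the Borel
`σ`-algebra of the vague topology. -/
instance : MeasurableSpace (PointConfig S) :=
  MeasurableSpace.comap toMeasure inferInstance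

/-- The restriction `ξ(· ∩ A)`. -/
def restrict (A : Set S) (ξ : PointConfig S) : PointConfig S where
  mult := A.indicator ξ.mult
  finite_inter K hK := (ξ.finite_inter K hK).subset
    (Set.inter_subset_inter_right K (by rw [Set.support_indicator]; exact Set.inter_subset_right))

/-- The superposition of two configurations. -/
instance : Add (PointConfig S) where
  add ξ η :=
    { mult := ξ.mult + η.mult
      finite_inter := fun K hK => ((ξ.finite_inter K hK).union (η.finite_inter K hK)).subset
        (by
          rw [← Set.inter_union_distrib_left]
          exact Set.inter_subset_inter_right K (Function.support_add _ _)) }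

open Classical in
/-- The unlabelled configuration `∑ᵢ δ_{xᵢ}` of a finite tuple. -/
def ofTuple {n : ℕ} (x : Fin n → S) : PointConfig S where
  mult z := (Finset.univ.filter fun i => x i = z).card
  finite_inter K _ := (Set.finite_range x).subset (by
    rintro z ⟨-, hz⟩
    obtain ⟨i, hi⟩ := Finset.card_ne_zero.mp hz
    exact ⟨i, (Finset.mem_filter.mp hi).2⟩)

open Classical in
/-- `ξ \ x`: one particle at `x` is removed (meaningful if there is one). -/
def erase (ξ : PointConfig S) (x : S) : PointConfig S where
  mult z := ξ.mult z - if z = x then 1 else 0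
  finite_inter K hK := (ξ.finite_inter K hK).subset (by
    rintro z ⟨hzK, hz⟩
    refine ⟨hzK, fun h => hz ?_⟩
    simp [h])

/-- `ξ^{xy}`: one particle jumps from `x` to `y`. -/
def jump (ξ : PointConfig S) (x y : S) : PointConfig S :=
  ξ.erase x + ofTuple (n := 1) fun _ => y

end PointConfig

section JumpForm

variable {d : ℕ} {S : Set (EuclideanSpace ℝ (Fin d))}

/-- Lebesgue measure on `S`. -/
def lebesgueOn (S : Set (EuclideanSpace ℝ (Fin d))) : Measure S :=
  (volume : Measure (EuclideanSpace ℝ (Fin d))).comap Subtype.val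

/-- `U_r = {x ∈ S : |x| ≤ r}`. -/
def ballIn (S : Set (EuclideanSpace ℝ (Fin d))) (r : ℕ) : Set S :=
  {x | ‖(x : EuclideanSpace ℝ (Fin d))‖ ≤ r}

/-- `𝔐_{r,n}`: the configurations with exactly `n` particles in `U_r`. -/
def configsWith (S : Set (EuclideanSpace ℝ (Fin d))) (r n : ℕ) : Set (PointConfig S) :=
  {ξ | ξ.toMeasure (ballIn S r) = n}

/-- `π_r ξ`: the configuration inside `U_r`. -/
def inside (r : ℕ) (ξ : PointConfig S) : PointConfig S := ξ.restrict (ballIn S r)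

/-- `π_r^c ξ`: the configuration outside `U_r`. -/
def outside (r : ℕ) (ξ : PointConfig S) : PointConfig S := ξ.restrict (ballIn S r)ᶜ

open Classical in
/-- The `U_r^n`-representation `f_{r,ξ}^n` of `f` (relevant for tuples of points of `U_r`): the
particles outside `U_r` are those of `ξ`, those inside are the given ones. -/
def localRep (f : PointConfig S → ℝ) (r n : ℕ) (ξ : PointConfig S) (x : Fin n → S) : ℝ :=
  if ξ ∈ configsWith S r n then f (PointConfig.ofTuple x + outside r ξ) else 0

/-- Local functions: those which are `σ[π_r]`-measurable for some `r`. -/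
def IsLocalFun (f : PointConfig S → ℝ) : Prop :=
  ∃ r : ℕ, Measurable[MeasurableSpace.comap (inside (S := S) r) inferInstance] f

/-- Local smooth functions `𝔇_∘`. Smoothness on the closed set `U_r^n` means that there is a `C^∞`
extension to `(ℝ^d)^n`. -/
def localSmooth (S : Set (EuclideanSpace ℝ (Fin d))) : Set (PointConfig S → ℝ) :=
  {f | IsLocalFun f ∧ ∀ (r n : ℕ) (ξ : PointConfig S),
    ∃ F : (Fin n → EuclideanSpace ℝ (Fin d)) → ℝ, ContDiff ℝ (⊤ : ℕ∞) F ∧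
      ∀ x : Fin n → S, (∀ i, x i ∈ ballIn S r) → localRep f r n ξ x = F fun i => x i}

/-- The increment `f(ξ^{xy}) - f(ξ)`. -/
def jumpDiff (f : PointConfig S → ℝ) (ξ : PointConfig S) (x y : S) : ℝ :=
  f (ξ.jump x y) - f ξ

/-- The square field `𝔻[f,g](ξ) = ½ ∫ ξ(dx) ∫_S (f(ξ^{xy}) - f(ξ)) (g(ξ^{xy}) - g(ξ)) ν(ξ,x;y) dy`. -/
def squareField (ν : PointConfig S → S → S → ℝ≥0) (f g : PointConfig S → ℝ)
    (ξ : PointConfig S) : ℝ :=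
  1 / 2 * ∫ x, ∫ y, jumpDiff f ξ x y * jumpDiff g ξ x y * (ν ξ x y : ℝ) ∂(lebesgueOn S) ∂ξ.toMeasure

/-- The bilinear form `𝔈(f,g) = ∫ 𝔻[f,g] dμ` (for `f, g` in the domain below all integrals involved
converge absolutely, `μ`-almost surely for the inner ones). -/
def jumpForm (ν : PointConfig S → S → S → ℝ≥0) (μ : Measure (PointConfig S))
    (f g : PointConfig S → ℝ) : ℝ :=
  ∫ ξ, squareField ν f g ξ ∂μ

/-- `𝔈(f,f)` as an element of `[0,∞]`. -/
def jumpEnergy (ν : PointConfig S → S → S → ℝ≥0) (μ : Measure (PointConfig S))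
    (f : PointConfig S → ℝ) : ℝ≥0∞ :=
  ∫⁻ ξ, 1 / 2 * ∫⁻ x, ∫⁻ y, ENNReal.ofReal (jumpDiff f ξ x y ^ 2) * (ν ξ x y : ℝ≥0∞)
    ∂(lebesgueOn S) ∂ξ.toMeasure ∂μ

/-- `𝔇_∞`: the local smooth functions in `L²(μ)` with `𝔈(f,f) < ∞`. -/
def jumpDomain (ν : PointConfig S → S → S → ℝ≥0) (μ : Measure (PointConfig S)) :
    Set (PointConfig S → ℝ) :=
  {f | f ∈ localSmooth S ∧ MemLp f 2 μ ∧ jumpEnergy ν μ f < ∞}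

/-- A form `(𝓔, D)` given on functions is closable on `L²(μ)`: every `𝓔`-Cauchy sequence in `D` which
converges to `0` in `L²(μ)` satisfies `𝓔(fₙ,fₙ) → 0`. -/
def IsClosableForm {Ω : Type*} [MeasurableSpace Ω] (μ : Measure Ω) (D : Set (Ω → ℝ))
    (𝓔 : (Ω → ℝ) → (Ω → ℝ) → ℝ) : Prop :=
  ∀ f : ℕ → Ω → ℝ, (∀ n, f n ∈ D) →
    Tendsto (fun p : ℕ × ℕ => 𝓔 (f p.1 - f p.2) (f p.1 - f p.2)) atTop (𝓝 0) →
    Tendsto (fun n => eLpNorm (f n) 2 μ) atTop (𝓝 0) →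
    Tendsto (fun n => 𝓔 (f n) (f n)) atTop (𝓝 0)

open Classical in
/-- The Hamiltonian `∑_{xᵢ ∈ A} Φ(xᵢ) + ∑_{i < j, xᵢ, xⱼ ∈ A} Ψ(xᵢ,xⱼ)`. -/
def hamiltonian (Φ : S → EReal) (Ψ : S → S → EReal) (A : Set S) {n : ℕ} (x : Fin n → S) : EReal :=
  (∑ i, if x i ∈ A then Φ (x i) else 0) +
    ∑ i, ∑ j, if i < j ∧ x i ∈ A ∧ x j ∈ A then Ψ (x i) (x j) else 0

/-- The measure `e^{-H_r} 1_{𝔐_{r,n}} dΛ` on configurations in `U_r`. Here `Λ` is the Poisson random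
point field with Lebesgue intensity on `S`: under `Λ`, the configuration in `U_r` has, on `𝔐_{r,n}`, the
law `e^{-|U_r|} / n!` times the image of Lebesgue measure on `U_r^n` under
`(x₁,…,xₙ) ↦ ∑ᵢ δ_{xᵢ}`. -/
def gibbsWeight (Φ : S → EReal) (Ψ : S → S → EReal) (r n : ℕ) : Measure (PointConfig S) :=
  (ENNReal.ofReal (Real.exp (-(lebesgueOn S (ballIn S r)).toReal)) / (n.factorial : ℝ≥0∞)) •
    ((Measure.pi fun _ : Fin n => (lebesgueOn S).restrict (ballIn S r)).withDensity
      fun x => EReal.exp (-hamiltonian Φ Ψ (ballIn S r) x)).map PointConfig.ofTuple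

/-- `μ` is a `(Φ,Ψ)`-quasi-Gibbs measure. The measures `μ_{r,k}^n` are `m r n k`, and the kernel
`κ` is the regular conditional distribution of `π_r ξ` given `π_r^c ξ` under `m r n k`. -/
def IsQuasiGibbs (Φ : S → EReal) (Ψ : S → S → EReal) (μ : Measure (PointConfig S)) : Prop :=
  ∃ b : ℕ → ℕ, StrictMono b ∧ (∀ r, 0 < b r) ∧
    ∃ m : ℕ → ℕ → ℕ → Measure (PointConfig S), ∀ r n : ℕ,
      (∀ k, IsFiniteMeasure (m r n k)) ∧
      (∀ k, m r n k ≤ m r n (k + 1)) ∧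
      (∀ F : BoundedContinuousFunction (PointConfig S) ℝ,
        Tendsto (fun k => ∫ ξ, F ξ ∂(m r n k)) atTop
          (𝓝 (∫ ξ, F ξ ∂(μ.restrict (configsWith S (b r) n))))) ∧
      ∀ k, ∃ κ : Kernel (PointConfig S) (PointConfig S), IsMarkovKernel κ ∧
        ((m r n k).map fun ξ => (outside (b r) ξ, inside (b r) ξ)).IsCondKernel κ ∧
        ∀ᵐ ξ ∂(m r n k), ∃ C : ℝ≥0, 0 < C ∧
          C⁻¹ • gibbsWeight Φ Ψ (b r) n ≤ κ (outside (b r) ξ) ∧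
          κ (outside (b r) ξ) ≤ C • gibbsWeight Φ Ψ (b r) n

/-- `V` is comparable up to multiplicative constants to an upper semi-continuous function with values in
`ℝ ∪ {∞}`. -/
def ComparableToUSC {X : Type*} [TopologicalSpace X] (V : X → EReal) : Prop :=
  ∃ V₀ : X → EReal, UpperSemicontinuous V₀ ∧ (∀ s, V₀ s ≠ ⊥) ∧
    ∃ C : ℝ, 0 < C ∧ ∀ s, ((C⁻¹ : ℝ) : EReal) * V₀ s ≤ V s ∧ V s ≤ (C : EReal) * V₀ s

end JumpForm

end

/-! The engine is Fatou's lemma. If `f_p → 0` in `L²(μ)`, a subsequence `f_{q_j}` tends to `0`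
outside a `μ`-null set `A`. Suppose that for almost all `(ξ, x, y)` under `μ(dξ) ξ(dx) ν(ξ,x;y) dy`
neither `ξ` nor `ξ^{xy}` lies in `A`. Then the increments of `f_p - f_{q_j}` converge to those of
`f_p`, so `𝔈(f_p,f_p) ≤ liminf_j 𝔈(f_p - f_{q_j}, f_p - f_{q_j})` (`jumpEnergy_le_liminf_sub`), and
the Cauchy property makes the right side small for large `p`.

What remains is that jumps do not hit `μ`-null sets (`ae_jump_notMem_of_isQuasiGibbs`). Given the
configuration outside a ball and the number of particles inside, the quasi-Gibbs property makes the
inner law equivalent to Lebesgue measure on tuples of finite energy. A jump inside the ball replaces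
one coordinate, and by Fubini (`ae_ae_update_of_ae_pi`) almost every replacement avoids `A` unless
its energy is infinite. Infinite energy is excluded because `Φ < ∞` almost everywhere and jumps to
points of infinite interaction have rate zero (`ae_jump_notMem_of_condKernel`).

These conditional bounds hold for the approximating measures, which converge only weakly. Since they
increase, they also converge setwise, and vaguely continuous functions identify the two limits
(`null_of_monotone_vague_limit`). Hence a set null for all approximations is null for the limit. -/

noncomputable section

/-! ### Configurations as measures, and measurability of the basic operations -/

namespace PointConfig

variable {d : ℕ} {S : Set (EuclideanSpace ℝ (Fin d))}

@[simp]
lemma add_mult (ξ η : PointConfig S) (z : S) : (ξ + η).mult z = ξ.mult z + η.mult z := rfl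

lemma toMeasure_apply (ξ : PointConfig S) {A : Set S} (hA : MeasurableSet A) :
    ξ.toMeasure A = ∑' x, (ξ.mult x : ℝ≥0∞) * A.indicator 1 x := by
  simp [toMeasure, Measure.sum_apply _ hA, Measure.dirac_apply' _ hA]

lemma toMeasure_add (ξ η : PointConfig S) :
    (ξ + η).toMeasure = ξ.toMeasure + η.toMeasure := by
  ext A hA
  simp [toMeasure_apply _ hA, add_mul, ENNReal.tsum_add]

lemma toMeasure_restrict (ξ : PointConfig S) {U : Set S} (hU : MeasurableSet U) :
    (ξ.restrict U).toMeasure = ξ.toMeasure.restrict U := by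
  ext A hA
  rw [Measure.restrict_apply hA, toMeasure_apply _ hA, toMeasure_apply _ (hA.inter hU)]
  refine tsum_congr fun x => ?_
  by_cases h1 : x ∈ U <;> by_cases h2 : x ∈ A <;> simp [restrict, h1, h2]

lemma toMeasure_singleton (ξ : PointConfig S) (x : S) : ξ.toMeasure {x} = ξ.mult x := by
  rw [toMeasure_apply _ (measurableSet_singleton x), tsum_eq_single x]
  · simp
  · intro y hy
    simp [hy]

lemma ofTuple_toMeasure {n : ℕ} (x : Fin n → S) :
    (ofTuple x).toMeasure = ∑ i, Measure.dirac (x i) := by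
  ext A hA
  rw [toMeasure_apply _ hA, Measure.finsetSum_apply]
  have h : ∀ z, ((ofTuple x).mult z : ℝ≥0∞) * A.indicator 1 z
      = ∑ i, if z = x i then A.indicator (1 : S → ℝ≥0∞) z else 0 := by
    intro z
    simp only [ofTuple, Finset.card_filter]
    push_cast
    rw [Finset.sum_mul]
    refine Finset.sum_congr rfl fun i _ => ?_
    by_cases h : x i = z <;> simp [h]
    intro h'; exact absurd h'.symm h
  simp_rw [h]
  rw [Summable.tsum_finsetSum fun _ _ => ENNReal.summable]
  refine Finset.sum_congr rfl fun i _ => ?_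
  rw [tsum_ite_eq, Measure.dirac_apply' _ hA]

lemma toMeasure_lt_top (ξ : PointConfig S) {K : Set S} (hK : IsCompact K) :
    ξ.toMeasure K < ∞ := by
  rw [toMeasure_apply _ hK.measurableSet,
    tsum_eq_sum (s := (ξ.finite_inter K hK).toFinset)]
  · refine ENNReal.sum_lt_top.2 fun x _ => ENNReal.mul_lt_top (by simp) ?_
    by_cases h : x ∈ K <;> simp [h]
  · intro x hx
    by_cases h : x ∈ K
    · have : ξ.mult x = 0 := by
        by_contra h'
        exact hx (by simpa using ⟨h, h'⟩)
      simp [this]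
    · simp [h]

lemma toMeasure_eq_natCast (ξ : PointConfig S) {K : Set S} (hK : IsCompact K) :
    ∃ n : ℕ, ξ.toMeasure K = n := by
  classical
  refine ⟨∑ x ∈ (ξ.finite_inter K hK).toFinset, ξ.mult x, ?_⟩
  rw [toMeasure_apply _ hK.measurableSet,
    tsum_eq_sum (s := (ξ.finite_inter K hK).toFinset)]
  · push_cast
    refine Finset.sum_congr rfl fun x hx => ?_
    have : x ∈ K := by
      have := (Set.Finite.mem_toFinset _).1 hx
      exact this.1
    simp [this]
  · intro x hx
    by_cases h : x ∈ K
    · have : ξ.mult x = 0 := by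
        by_contra h'
        exact hx (by simpa using ⟨h, h'⟩)
      simp [this]
    · simp [h]

lemma measurable_toMeasure : Measurable (toMeasure : PointConfig S → Measure S) :=
  comap_measurable _

lemma measurable_iff {α : Type*} [MeasurableSpace α] {f : α → PointConfig S} :
    Measurable f ↔ Measurable fun a => (f a).toMeasure := by
  rw [measurable_comap_iff]
  rfl

lemma measurable_of_apply {α : Type*} [MeasurableSpace α] {f : α → PointConfig S}
    (h : ∀ A : Set S, MeasurableSet A → Measurable fun a => (f a).toMeasure A) :
    Measurable f :=
  measurable_iff.2 (Measure.measurable_of_measurable_coe _ h)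

lemma measurable_apply {A : Set S} (hA : MeasurableSet A) :
    Measurable fun ξ : PointConfig S => ξ.toMeasure A :=
  (Measure.measurable_coe hA).comp measurable_toMeasure

lemma measurable_restrict {U : Set S} (hU : MeasurableSet U) :
    Measurable fun ξ : PointConfig S => ξ.restrict U := by
  refine measurable_of_apply fun A hA => ?_
  simp_rw [toMeasure_restrict _ hU, Measure.restrict_apply hA]
  exact measurable_apply (hA.inter hU)

lemma measurable_add : Measurable fun p : PointConfig S × PointConfig S => p.1 + p.2 := by
  refine measurable_of_apply fun A hA => ?_
  simp_rw [toMeasure_add, Measure.add_apply]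
  exact ((measurable_apply hA).comp measurable_fst).add ((measurable_apply hA).comp measurable_snd)

lemma measurable_ofTuple {n : ℕ} : Measurable (ofTuple : (Fin n → S) → PointConfig S) := by
  refine measurable_of_apply fun A hA => ?_
  simp_rw [ofTuple_toMeasure, Measure.finsetSum_apply, Measure.dirac_apply' _ hA]
  exact Finset.measurable_sum _ fun i _ =>
    (measurable_one.indicator hA).comp (measurable_pi_apply i)

lemma restrict_compl_add_restrict (ξ : PointConfig S) (U : Set S) :
    ξ.restrict Uᶜ + ξ.restrict U = ξ := by
  ext z
  by_cases h : z ∈ U <;> simp [restrict, h]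

lemma erase_add_single (ξ : PointConfig S) {x : S} (hx : ξ.mult x ≠ 0) :
    ξ.erase x + ofTuple (n := 1) (fun _ => x) = ξ := by
  classical
  ext z
  by_cases h : z = x
  · subst h
    simp [erase, ofTuple]
    omega
  · simp [erase, ofTuple, Ne.symm h, eq_comm]

lemma erase_of_mult_eq_zero (ξ : PointConfig S) {x : S} (hx : ξ.mult x = 0) : ξ.erase x = ξ := by
  classical
  ext z
  by_cases h : z = x
  · subst h
    simp [erase, hx]
  · simp [erase, h]

/-- The factor `min 1 (ξ {x})` covers the case without a particle at `x`, where erasing does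
nothing. The right side is built from quantities measurable jointly in `ξ` and `x`, which yields
measurability of the jump map. -/
lemma erase_toMeasure_apply (ξ : PointConfig S) (x : S) {A : Set S} (hA : MeasurableSet A) :
    (ξ.erase x).toMeasure A = ξ.toMeasure A - min 1 (ξ.toMeasure {x}) * A.indicator 1 x := by
  by_cases hx : ξ.mult x = 0
  · simp [erase_of_mult_eq_zero ξ hx, toMeasure_singleton, hx]
  · have h1 : min 1 (ξ.toMeasure {x}) = 1 := by
      rw [toMeasure_singleton, min_eq_left]
      exact_mod_cast Nat.one_le_iff_ne_zero.2 hx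
    conv_rhs => rw [h1]
    conv_rhs => rw [← erase_add_single ξ hx]
    rw [toMeasure_add, Measure.add_apply, ofTuple_toMeasure]
    simp only [Finset.univ_unique, Finset.sum_const, Finset.card_singleton, one_smul,
      Measure.dirac_apply' _ hA, one_mul]
    refine (ENNReal.add_sub_cancel_right ?_).symm
    by_cases h : x ∈ A <;> simp [h]

end PointConfig

/-! ### Exhaustion by balls, the configuration kernel and the jump map -/

section Balls

variable {d : ℕ} {S : Set (EuclideanSpace ℝ (Fin d))}

lemma isCompact_ballIn (hS : IsClosed S) (r : ℕ) : IsCompact (ballIn S r) := by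
  have h : ballIn S r = Subtype.val ⁻¹' (Metric.closedBall (0 : EuclideanSpace ℝ (Fin d)) r) := by
    ext x
    simp [ballIn]
  rw [h]
  exact hS.isClosedEmbedding_subtypeVal.isCompact_preimage (isCompact_closedBall _ _)

lemma measurableSet_ballIn (r : ℕ) : MeasurableSet (ballIn S r) :=
  measurableSet_le (by fun_prop) (by fun_prop)

lemma exists_mem_ballIn (x : S) : ∃ r, x ∈ ballIn S r :=
  exists_nat_ge ‖(x : EuclideanSpace ℝ (Fin d))‖

lemma ballIn_mono {r s : ℕ} (h : r ≤ s) : ballIn S r ⊆ ballIn S s := fun x hx =>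
  le_trans (show ‖(x : EuclideanSpace ℝ (Fin d))‖ ≤ r from hx) (by exact_mod_cast h)

lemma iUnion_ballIn : ⋃ r, ballIn S r = Set.univ :=
  Set.eq_univ_of_forall fun x => Set.mem_iUnion.2 (exists_mem_ballIn x)

lemma lebesgueOn_ballIn_lt_top (hS : IsClosed S) (r : ℕ) : lebesgueOn S (ballIn S r) < ∞ := by
  rw [lebesgueOn, comap_subtype_coe_apply hS.measurableSet]
  refine lt_of_le_of_lt (measure_mono ?_)
    (measure_closedBall_lt_top (x := (0 : EuclideanSpace ℝ (Fin d))) (r := r))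
  rintro _ ⟨x, hx, rfl⟩
  simpa [ballIn] using hx

lemma sigmaFinite_lebesgueOn (hS : IsClosed S) : SigmaFinite (lebesgueOn S) :=
  ⟨⟨⟨ballIn S, fun _ => trivial, lebesgueOn_ballIn_lt_top hS, iUnion_ballIn⟩⟩⟩

/-- Every particle is an atom, and the support is countable, being a union of finite sets over an
exhaustion by compact balls. -/
lemma ae_toMeasure_iff (hS : IsClosed S) (ξ : PointConfig S) {p : S → Prop} :
    (∀ᵐ x ∂ξ.toMeasure, p x) ↔ ∀ x, ξ.mult x ≠ 0 → p x := by
  constructor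
  · intro h x hx
    by_contra hp
    have : ξ.toMeasure {x} = 0 := measure_mono_null (by simpa using hp) h
    rw [PointConfig.toMeasure_singleton] at this
    exact hx (by exact_mod_cast this)
  · intro h
    have hc : (Function.support ξ.mult).Countable := by
      have : Function.support ξ.mult = ⋃ r, ballIn S r ∩ Function.support ξ.mult := by
        rw [← Set.iUnion_inter, iUnion_ballIn, Set.univ_inter]
      rw [this]
      exact Set.countable_iUnion fun r => (ξ.finite_inter _ (isCompact_ballIn hS r)).countable
    have h0 : ξ.toMeasure (Function.support ξ.mult)ᶜ = 0 := by
      rw [ξ.toMeasure_apply hc.measurableSet.compl, ENNReal.tsum_eq_zero]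
      intro x
      by_cases hx : ξ.mult x = 0 <;> simp [hx]
    exact measure_mono_null (fun x hx hx' => hx (h x hx')) h0

/-- The configuration, as a kernel. -/
def configKernel (S : Set (EuclideanSpace ℝ (Fin d))) : Kernel (PointConfig S) S :=
  ⟨PointConfig.toMeasure, PointConfig.measurable_toMeasure⟩

@[simp]
lemma configKernel_apply (ξ : PointConfig S) : configKernel S ξ = ξ.toMeasure := rfl

lemma measurableSet_configsWith (r n : ℕ) : MeasurableSet (configsWith S r n) :=
  PointConfig.measurable_apply (measurableSet_ballIn r) (measurableSet_singleton _)

lemma iUnion_configsWith (hS : IsClosed S) (r : ℕ) : ⋃ n, configsWith S r n = Set.univ :=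
  Set.eq_univ_of_forall fun ξ =>
    Set.mem_iUnion.2 (ξ.toMeasure_eq_natCast (isCompact_ballIn hS r))

lemma isSFiniteKernel_configKernel (hS : IsClosed S) : IsSFiniteKernel (configKernel S) := by
  classical
  let D : ℕ → Set S := disjointed (ballIn S)
  have hD : ∀ r, MeasurableSet (D r) := fun r =>
    MeasurableSet.disjointed measurableSet_ballIn r
  have hDU : ∀ r, D r ⊆ ballIn S r := disjointed_subset _
  -- Particle numbers in a ball have no bound uniform in `ξ`, so each shell is cut further according
  -- to the number `n` of particles in its ball. Each piece then has mass at most `n`.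
  let κ : ℕ × ℕ → Kernel (PointConfig S) S := fun p =>
    Kernel.piecewise (measurableSet_configsWith (S := S) p.1 p.2)
      ((configKernel S).restrict (hD p.1)) 0
  have hfin : ∀ p, IsFiniteKernel (κ p) := fun p => by
    refine ⟨⟨p.2, by simp, fun ξ => ?_⟩⟩
    by_cases h : ξ ∈ configsWith S p.1 p.2
    · simp only [κ, Kernel.piecewise_apply, h, if_true, Kernel.restrict_apply, configKernel_apply,
        Measure.restrict_apply_univ]
      exact (measure_mono (hDU _)).trans (le_of_eq h)
    · simp [κ, Kernel.piecewise_apply, h]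
  have hsum : configKernel S = Kernel.sum κ := by
    ext ξ A hA
    rw [Kernel.sum_apply' _ _ hA, ENNReal.tsum_prod (f := fun r n => κ (r, n) ξ A)]
    have h1 : ∀ r, ∑' n, κ (r, n) ξ A = ξ.toMeasure (A ∩ D r) := by
      intro r
      obtain ⟨n, hn⟩ := ξ.toMeasure_eq_natCast (isCompact_ballIn hS r)
      rw [tsum_eq_single n]
      · have : ξ ∈ configsWith S r n := hn
        simp [κ, Kernel.piecewise_apply, this, Kernel.restrict_apply, Measure.restrict_apply hA]
      · intro m hm
        have : ξ ∉ configsWith S r m := fun h => hm <| by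
          have := h.symm.trans hn
          exact_mod_cast this
        simp [κ, Kernel.piecewise_apply, this]
    simp_rw [h1]
    rw [← measure_iUnion, ← Set.inter_iUnion]
    · simp [D, iUnion_disjointed, iUnion_ballIn]
    · exact fun i j hij => ((disjoint_disjointed (ballIn S) hij).mono
        Set.inter_subset_right Set.inter_subset_right)
    · exact fun r => hA.inter (hD r)
  rw [hsum]
  exact Kernel.isSFiniteKernel_sum (hκs := fun p => inferInstance)

lemma measurable_toMeasure_singleton (hS : IsClosed S) :
    Measurable fun p : PointConfig S × S => p.1.toMeasure {p.2} := by
  have := isSFiniteKernel_configKernel hS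
  -- The singleton `{x}` varies with `x`; it is a section of the measurable diagonal.
  have h := Kernel.measurable_kernel_prodMk_left
    (κ := (configKernel S).comap (Prod.fst : PointConfig S × S → _) measurable_fst)
    (t := {q | q.2 = q.1.2}) (measurableSet_eq_fun (by fun_prop) (by fun_prop))
  convert h using 2 with p
  rw [Kernel.comap_apply, configKernel_apply]
  rfl

lemma measurable_jump (hS : IsClosed S) :
    Measurable fun p : (PointConfig S × S) × S => p.1.1.jump p.1.2 p.2 := by
  refine PointConfig.measurable_of_apply fun A hA => ?_
  simp_rw [PointConfig.jump, PointConfig.toMeasure_add, Measure.add_apply,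
    PointConfig.erase_toMeasure_apply _ _ hA, PointConfig.ofTuple_toMeasure]
  simp only [Finset.univ_unique, Finset.sum_const, Finset.card_singleton, one_smul,
      Measure.dirac_apply' _ hA]
  have hI : Measurable (A.indicator (1 : S → ℝ≥0∞)) := measurable_one.indicator hA
  have h1 := measurable_toMeasure_singleton hS
  have h2 := PointConfig.measurable_apply hA
  exact ((h2.comp (by fun_prop)).sub
    ((measurable_const.min (h1.comp measurable_fst)).mul (hI.comp (by fun_prop)))).add
    (hI.comp (by fun_prop))

end Balls

/-! ### Setwise limits of increasing measures -/

section MonotoneLimit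

variable {Ω : Type*} [MeasurableSpace Ω]

/-- A bounded increasing sequence of finite measures converges setwise to a finite measure. -/
lemma exists_limit_of_monotone_measures (m : ℕ → Measure Ω) [∀ k, IsFiniteMeasure (m k)]
    (hm : ∀ k, m k ≤ m (k + 1)) {c : ℝ≥0∞} (hc : c ≠ ∞) (hmc : ∀ k, m k Set.univ ≤ c) :
    ∃ M : Measure Ω, IsFiniteMeasure M ∧ (∀ k, m k ≤ M) ∧
      (∀ B, (∀ k, m k B = 0) → M B = 0) ∧
      ∀ F : Ω → ℝ, Measurable F → (∃ b, ∀ x, ‖F x‖ ≤ b) →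
        Tendsto (fun k => ∫ x, F x ∂(m k)) atTop (𝓝 (∫ x, F x ∂M)) := by
  let e : ℕ → Measure Ω := fun j => m (j + 1) - m j
  have he : ∀ j, e j + m j = m (j + 1) := fun j => Measure.sub_add_cancel_of_le (hm j)
  have hpart : ∀ k, m k = m 0 + ∑ j ∈ Finset.range k, e j := by
    intro k
    induction k with
    | zero => simp
    | succ k ih =>
      rw [Finset.sum_range_succ, ← add_assoc, ← ih, add_comm (m k), he]
  -- The telescoping series of the increments `e j = m (j + 1) - m j`; its partial sums are the `m
  -- k`.
  let M := m 0 + Measure.sum e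
  have hle : ∀ k, m k ≤ M := by
    intro k
    rw [hpart k, Measure.le_iff]
    intro B hB
    simp only [M, Measure.add_apply, Measure.finsetSum_apply, Measure.sum_apply _ hB]
    gcongr
    exact ENNReal.sum_le_tsum _
  have hMc : M Set.univ ≤ c := by
    simp only [M, Measure.add_apply, Measure.sum_apply _ MeasurableSet.univ]
    rw [ENNReal.tsum_eq_iSup_nat, ENNReal.add_iSup]
    refine iSup_le fun k => ?_
    have := hmc k
    rwa [hpart k, Measure.add_apply, Measure.finsetSum_apply] at this
  have hMfin : IsFiniteMeasure M := ⟨hMc.trans_lt hc.lt_top⟩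
  refine ⟨M, hMfin, hle, fun B hB => ?_, fun F hF hb => ?_⟩
  · have he0 : ∀ j, e j B = 0 := fun j => by
      have h := hB (j + 1)
      rw [← he j, Measure.add_apply] at h
      exact (add_eq_zero.1 h).1
    simp only [M, Measure.add_apply, hB 0, zero_add]
    exact (Measure.sum_apply_eq_zero).2 he0
  · obtain ⟨b, hb⟩ := hb
    have hint : ∀ (μ : Measure Ω), μ ≤ M → Integrable F μ := fun μ hμ =>
      (Integrable.of_bound hF.aestronglyMeasurable b (Eventually.of_forall hb)).mono_measure hμ
    have hsum : Measure.sum e ≤ M := Measure.le_add_left le_rfl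
    have h := hasSum_integral_measure (hint _ hsum)
    have hek : ∀ j, e j ≤ M := fun j => (Measure.le_sum e j).trans hsum
    have heq : ∀ k, ∫ x, F x ∂(m k) = ∫ x, F x ∂(m 0) + ∑ j ∈ Finset.range k, ∫ x, F x ∂(e j) := by
      intro k
      conv_lhs => rw [hpart k]
      rw [integral_add_measure (hint _ (hle 0))
        (integrable_finsetSum_measure.2 fun j _ => hint _ (hek j)),
        integral_finsetSum_measure fun j _ => hint _ (hek j)]
    rw [integral_add_measure (hint _ (hle 0)) (hint _ hsum), tendsto_congr heq]
    exact h.tendsto_sum_nat.const_add _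

end MonotoneLimit

/-! ### The vague topology determines finite measures -/

section Vague

variable {d : ℕ} {S : Set (EuclideanSpace ℝ (Fin d))}

lemma continuous_integral_toMeasure (φ : CompactlySupportedContinuousMap S ℝ) :
    Continuous fun ξ : PointConfig S => ∫ x, φ x ∂ξ.toMeasure :=
  continuous_iff_le_induced.2 (iInf_le _ φ)

lemma measurable_integral_toMeasure (hS : IsClosed S) (φ : CompactlySupportedContinuousMap S ℝ) :
    Measurable fun ξ : PointConfig S => ∫ x, φ x ∂ξ.toMeasure := by
  have := isSFiniteKernel_configKernel hS
  exact (StronglyMeasurable.integral_kernel (κ := configKernel S)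
    (f := φ) φ.continuous.stronglyMeasurable).measurable

lemma isFiniteMeasureOnCompacts_toMeasure (ξ : PointConfig S) :
    IsFiniteMeasureOnCompacts ξ.toMeasure :=
  ⟨fun _ hK => ξ.toMeasure_lt_top hK⟩

/-- The `σ`-algebra on configurations is generated by the integrals of test functions. -/
lemma measurableSpace_le_comap_integral (hS : IsClosed S) :
    (inferInstance : MeasurableSpace (PointConfig S)) ≤
      MeasurableSpace.comap
        (fun ξ (φ : CompactlySupportedContinuousMap S ℝ) => ∫ x, φ x ∂ξ.toMeasure)
        MeasurableSpace.pi := by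
  have : LocallyCompactSpace S := hS.isClosedEmbedding_subtypeVal.locallyCompactSpace
  set σ : MeasurableSpace (PointConfig S) := MeasurableSpace.comap
    (fun ξ (φ : CompactlySupportedContinuousMap S ℝ) => ∫ x, φ x ∂ξ.toMeasure)
    MeasurableSpace.pi with hσ
  have hφ : ∀ φ : CompactlySupportedContinuousMap S ℝ,
      Measurable[σ] fun ξ : PointConfig S => ∫ x, φ x ∂ξ.toMeasure := fun φ =>
    @Measurable.comp _ _ _ σ _ _ (fun g : CompactlySupportedContinuousMap S ℝ → ℝ => g φ) _
      (measurable_pi_apply φ) (comap_measurable _)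
  have hK : ∀ K : Set S, IsCompact K → Measurable[σ] fun ξ : PointConfig S => ξ.toMeasure K := by
    intro K hK
    obtain ⟨f, hfK, -, hfc, hf01⟩ := exists_continuous_one_zero_of_isCompact_of_isGδ hK
      hK.isClosed.isGδ isClosed_empty (Set.disjoint_empty K)
    -- Since `f` equals `1` exactly on `K`, its powers decrease to the indicator of `K`. The
    -- exponent `n + 1` avoids `0 ^ 0 = 1`, which would destroy compact support and the domination
    -- by `f`.
    let φ : ℕ → CompactlySupportedContinuousMap S ℝ := fun n =>
      ⟨⟨fun x => f x ^ (n + 1), by fun_prop⟩,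
        hfc.comp_left (g := fun t : ℝ => t ^ (n + 1)) (by simp)⟩
    have hφe : ∀ n x, φ n x = f x ^ (n + 1) := fun _ _ => rfl
    have hreal : Measurable[σ] fun ξ : PointConfig S => ξ.toMeasure.real K := by
      refine @measurable_of_tendsto_metrizable _ _ σ _ _ _ _ _ _ (fun n => hφ (φ n)) ?_
      rw [tendsto_pi_nhds]
      intro ξ
      have := isFiniteMeasureOnCompacts_toMeasure ξ
      rw [← integral_indicator_one hK.measurableSet]
      refine tendsto_integral_of_dominated_convergence f
        (fun n => (φ n).continuous.aestronglyMeasurable)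
        (f.continuous.integrable_of_hasCompactSupport hfc)
        (fun n => Eventually.of_forall fun x => ?_) (Eventually.of_forall fun x => ?_)
      · rw [hφe, Real.norm_of_nonneg (pow_nonneg (hf01 x).1 _)]
        exact pow_le_of_le_one (hf01 x).1 (hf01 x).2 (by simp)
      · by_cases hx : x ∈ K
        · have h1 : f x = 1 := by rwa [hfK] at hx
          simp [hφe, hx, h1]
        · have h1 : f x < 1 := lt_of_le_of_ne (hf01 x).2 fun h => hx (by rw [hfK]; exact h)
          simp only [hφe, hx, not_false_eq_true, Set.indicator_of_notMem]
          exact (tendsto_add_atTop_iff_nat 1).2 (tendsto_pow_atTop_nhds_zero_of_lt_one (hf01 x).1 h1)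
    have : (fun ξ : PointConfig S => ξ.toMeasure K)
        = fun ξ => ENNReal.ofReal (ξ.toMeasure.real K) := by
      ext ξ
      rw [ofReal_measureReal (ξ.toMeasure_lt_top hK).ne]
    rw [this]
    exact ENNReal.measurable_ofReal.comp hreal
  -- Localising to a ball makes the measures finite, so the π-system of closed sets suffices.
  have hres : ∀ r, Measurable[σ] fun ξ : PointConfig S => ξ.toMeasure.restrict (ballIn S r) := by
    intro r
    have hfin : ∀ ξ : PointConfig S, IsFiniteMeasure (ξ.toMeasure.restrict (ballIn S r)) :=
      fun ξ => ⟨by simpa using ξ.toMeasure_lt_top (isCompact_ballIn hS r)⟩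
    refine @Measurable.measure_of_isPiSystem _ _ σ _ _ hfin _
      (BorelSpace.measurable_eq.trans borel_eq_generateFrom_isClosed) isPiSystem_isClosed
      (fun A hA => ?_) ?_
    · simp_rw [Measure.restrict_apply (IsClosed.measurableSet hA)]
      exact hK _ ((isCompact_ballIn hS r).inter_left hA)
    · simp_rw [Measure.restrict_apply_univ]
      exact hK _ (isCompact_ballIn hS r)
  refine measurable_iff_comap_le.1 (@Measure.measurable_of_measurable_coe _ _ _ σ _ fun A hA => ?_)
  have hsup : ∀ ξ : PointConfig S,
      ξ.toMeasure A = ⨆ r, ξ.toMeasure.restrict (ballIn S r) A := fun ξ => by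
    simp_rw [Measure.restrict_apply hA]
    rw [← Monotone.measure_iUnion, ← Set.inter_iUnion, iUnion_ballIn, Set.inter_univ]
    exact fun r s h => Set.inter_subset_inter_right _ (ballIn_mono h)
  simp_rw [hsup]
  exact Measurable.iSup fun r => (Measure.measurable_coe hA).comp (hres r)

/-- Bounded continuous functions for the vague topology separate finite measures. -/
lemma ext_of_integral_vague (hS : IsClosed S) {M M' : Measure (PointConfig S)}
    [IsFiniteMeasure M] [IsFiniteMeasure M']
    (h : ∀ F : BoundedContinuousFunction (PointConfig S) ℝ, Measurable F →
      ∫ ξ, F ξ ∂M = ∫ ξ, F ξ ∂M') : M = M' := by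
  let E : PointConfig S → CompactlySupportedContinuousMap S ℝ → ℝ :=
    fun ξ φ => ∫ x, φ x ∂ξ.toMeasure
  have hE : Measurable E := measurable_pi_lambda _ fun φ => measurable_integral_toMeasure hS φ
  have hEc : Continuous E := continuous_pi fun φ => continuous_integral_toMeasure φ
  have hmap : M.map E = M'.map E := by
    -- A finite measure on the product is determined by its finite-dimensional marginals. These are
    -- tested by bounded continuous functions of finitely many `∫ φ dξ`, which are vaguely
    -- continuous and measurable.
    refine IsProjectiveLimit.unique (P := fun J => (M.map E).map J.restrict)
      (fun J => rfl) fun J => ?_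
    have hJ := J.measurable_restrict (X := fun _ : CompactlySupportedContinuousMap S ℝ => ℝ)
    change (M'.map E).map J.restrict = (M.map E).map J.restrict
    rw [Measure.map_map hJ hE, Measure.map_map hJ hE]
    have hJE := hJ.comp hE
    refine ext_of_forall_integral_eq_of_IsFiniteMeasure fun g => ?_
    have hg : StronglyMeasurable g := g.continuous.stronglyMeasurable
    rw [integral_map hJE.aemeasurable hg.aestronglyMeasurable,
      integral_map hJE.aemeasurable hg.aestronglyMeasurable]
    have hJc : Continuous (J.restrict ∘ E) :=
      continuous_pi fun φ => (continuous_apply φ.1).comp hEc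
    exact (h (g.compContinuous ⟨_, hJc⟩) (g.continuous.measurable.comp hJE)).symm
  ext A hA
  obtain ⟨B, hB, rfl⟩ := measurableSpace_le_comap_integral hS A hA
  rw [← Measure.map_apply hE hB, hmap, Measure.map_apply hE hB]

/-- The increasing limit in the definition of quasi-Gibbs measures is a setwise one. -/
lemma null_of_monotone_vague_limit (hS : IsClosed S) (m : ℕ → Measure (PointConfig S))
    [∀ k, IsFiniteMeasure (m k)] (hm : ∀ k, m k ≤ m (k + 1)) (M : Measure (PointConfig S))
    [IsFiniteMeasure M]
    (hlim : ∀ F : BoundedContinuousFunction (PointConfig S) ℝ,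
        Tendsto (fun k => ∫ ξ, F ξ ∂(m k)) atTop (𝓝 (∫ ξ, F ξ ∂M))) :
    (∀ k, m k ≤ M) ∧ ∀ B, (∀ k, m k B = 0) → M B = 0 := by
  -- The test function `1` bounds the total masses by that of `M`.
  have h1 : Tendsto (fun k => (m k).real Set.univ) atTop (𝓝 (M.real Set.univ)) := by
    simpa using hlim (BoundedContinuousFunction.const _ 1)
  have hmono : Monotone fun k => (m k).real Set.univ := monotone_nat_of_le_succ fun k =>
    ENNReal.toReal_mono (measure_ne_top _ _) (hm k _)
  have hmc : ∀ k, m k Set.univ ≤ M Set.univ := fun k =>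
    (ENNReal.toReal_le_toReal (measure_ne_top _ _) (measure_ne_top _ _)).1 (hmono.ge_of_tendsto h1 k)
  obtain ⟨M', hfin, hle, hnull, hint⟩ :=
    exists_limit_of_monotone_measures m hm (measure_ne_top M _) hmc
  have : M' = M := ext_of_integral_vague hS fun F hF =>
    tendsto_nhds_unique (hint F hF ⟨‖F‖, F.norm_coe_le_norm⟩) (hlim F)
  subst this
  exact ⟨hle, hnull⟩

end Vague

/-- Almost every point keeps an almost sure property when one coordinate is resampled. -/
lemma ae_ae_update_of_ae_pi {X : Type*} [MeasurableSpace X] (ρ : Measure X) [SigmaFinite ρ] {n : ℕ}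
    {p : (Fin n → X) → Prop} (h : ∀ᵐ x ∂(Measure.pi fun _ : Fin n => ρ), p x) (i : Fin n) :
    ∀ᵐ x ∂(Measure.pi fun _ : Fin n => ρ), ∀ᵐ y ∂ρ, p (Function.update x i y) := by
  obtain _ | n := n
  · exact i.elim0
  have e := measurePreserving_piFinSuccAbove (fun _ : Fin (n + 1) => ρ) i
  have h1 : ∀ᵐ q ∂(ρ.prod (Measure.pi fun _ : Fin n => ρ)),
      p ((MeasurableEquiv.piFinSuccAbove (fun _ => X) i).symm q) :=
    e.symm.quasiMeasurePreserving.ae h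
  have h2 : ∀ᵐ x' ∂(Measure.pi fun _ : Fin n => ρ), ∀ᵐ y ∂ρ,
      p ((MeasurableEquiv.piFinSuccAbove (fun _ => X) i).symm (y, x')) :=
    Measure.ae_ae_of_ae_prod
      ((Measure.measurePreserving_swap
        (μ := Measure.pi fun _ : Fin n => ρ) (ν := ρ)).quasiMeasurePreserving.ae h1)
  have h3 := (Measure.quasiMeasurePreserving_snd (μ := ρ)
    (ν := Measure.pi fun _ : Fin n => ρ)).ae h2
  have h4 := e.quasiMeasurePreserving.ae h3
  filter_upwards [h4] with x hx
  filter_upwards [hx] with y hy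
  convert hy using 1
  simp [MeasurableEquiv.piFinSuccAbove, Fin.insertNthEquiv, Fin.insertNth_removeNth]

/-! ### Where the Hamiltonian is infinite -/

section Hamiltonian

variable {d : ℕ} {S : Set (EuclideanSpace ℝ (Fin d))}

lemma EReal.sum_ne_bot {ι : Type*} (s : Finset ι) (f : ι → EReal) (hf : ∀ i ∈ s, f i ≠ ⊥) :
    ∑ i ∈ s, f i ≠ ⊥ := by
  classical
  induction s using Finset.induction_on with
  | empty => simp
  | insert a s ha ih =>
    rw [Finset.sum_insert ha]
    simp only [ne_eq, EReal.add_eq_bot_iff, not_or]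
    exact ⟨hf a (Finset.mem_insert_self _ _), ih fun i hi => hf i (Finset.mem_insert_of_mem hi)⟩

lemma EReal.add_eq_top_iff_of_ne_bot {a b : EReal} (ha : a ≠ ⊥) (hb : b ≠ ⊥) :
    a + b = ⊤ ↔ a = ⊤ ∨ b = ⊤ := by
  refine ⟨fun h => ?_, ?_⟩
  · by_contra! h'
    exact EReal.add_ne_top h'.1 h'.2 h
  · rintro (rfl | rfl)
    · exact EReal.top_add_of_ne_bot hb
    · exact EReal.add_top_of_ne_bot ha

lemma EReal.sum_eq_top_iff {ι : Type*} (s : Finset ι) (f : ι → EReal) (hf : ∀ i ∈ s, f i ≠ ⊥) :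
    ∑ i ∈ s, f i = ⊤ ↔ ∃ i ∈ s, f i = ⊤ := by
  classical
  induction s using Finset.induction_on with
  | empty => simp
  | insert a s ha ih =>
    have hs : ∀ i ∈ s, f i ≠ ⊥ := fun i hi => hf i (Finset.mem_insert_of_mem hi)
    rw [Finset.sum_insert ha, EReal.add_eq_top_iff_of_ne_bot (hf a (Finset.mem_insert_self _ _))
      (EReal.sum_ne_bot s f hs), ih hs]
    simp

/-- No summand is `⊥`, so an infinite term cannot be absorbed by the convention `⊤ + ⊥ = ⊥`. -/
lemma hamiltonian_eq_top_iff {Φ : S → EReal} {Ψ : S → S → EReal} (hΦbot : ∀ x, Φ x ≠ ⊥)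
    (hΨbot : ∀ x y, Ψ x y ≠ ⊥) {U : Set S} {n : ℕ} {x : Fin n → S} (hx : ∀ i, x i ∈ U) :
    hamiltonian Φ Ψ U x = ⊤ ↔ (∃ i, Φ (x i) = ⊤) ∨ ∃ i j, i < j ∧ Ψ (x i) (x j) = ⊤ := by
  have hΨ' : ∀ i j, (if i < j then Ψ (x i) (x j) else 0) ≠ ⊥ := fun i j => by
    split_ifs
    exacts [hΨbot _ _, by simp]
  simp only [hamiltonian, hx, and_true, if_true]
  rw [EReal.add_eq_top_iff_of_ne_bot (EReal.sum_ne_bot _ _ fun i _ => hΦbot _)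
    (EReal.sum_ne_bot _ _ fun i _ => EReal.sum_ne_bot _ _ fun j _ => hΨ' i j),
    EReal.sum_eq_top_iff _ _ fun i _ => hΦbot _,
    EReal.sum_eq_top_iff _ _ fun i _ => EReal.sum_ne_bot _ _ fun j _ => hΨ' i j]
  simp_rw [EReal.sum_eq_top_iff _ _ fun j _ => hΨ' _ j]
  have h : ∀ i j, (if i < j then Ψ (x i) (x j) else 0) = ⊤ ↔ i < j ∧ Ψ (x i) (x j) = ⊤ :=
    fun i j => by split_ifs with h <;> simp [h]
  simp [h]

lemma measurable_hamiltonian {Φ : S → EReal} {Ψ : S → S → EReal} (hΦ : Measurable Φ)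
    (hΨ : Measurable (Function.uncurry Ψ)) {U : Set S} (hU : MeasurableSet U) (n : ℕ) :
    Measurable fun x : Fin n → S => hamiltonian Φ Ψ U x := by
  unfold hamiltonian
  refine (Finset.measurable_sum _ fun i _ => ?_).add
    (Finset.measurable_sum _ fun i _ => Finset.measurable_sum _ fun j _ => ?_)
  · exact Measurable.ite (measurable_pi_apply i hU) (hΦ.comp (measurable_pi_apply i))
      measurable_const
  · refine Measurable.ite ?_ ?_ measurable_const
    · exact (MeasurableSet.const _).inter ((measurable_pi_apply i hU).inter
        (measurable_pi_apply j hU))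
    · exact hΨ.comp (f := fun x : Fin n → S => (x i, x j))
        ((measurable_pi_apply i).prodMk (measurable_pi_apply j))

end Hamiltonian

/-! ### A jump as the update of one coordinate -/

section Jump

variable {d : ℕ} {S : Set (EuclideanSpace ℝ (Fin d))}

lemma PointConfig.ofTuple_mult {n : ℕ} (x : Fin n → S) (z : S) [DecidableEq S] :
    (ofTuple x).mult z = ∑ i, if x i = z then 1 else 0 := by
  rw [← Finset.card_filter]
  simp only [ofTuple]
  congr

lemma PointConfig.ofTuple_mult_ne_zero {n : ℕ} (x : Fin n → S) {z : S} :
    (ofTuple x).mult z ≠ 0 ↔ ∃ i, x i = z := by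
  simp [ofTuple, Finset.filter_eq_empty_iff]

lemma PointConfig.jump_ofTuple_add {n : ℕ} (x : Fin n → S) (η : PointConfig S) (i : Fin n) (y : S) :
    (ofTuple x + η).jump (x i) y = ofTuple (Function.update x i y) + η := by
  classical
  ext z
  have h1 : ∀ w : Fin n → S, (ofTuple w).mult z =
      (if w i = z then 1 else 0) + ∑ j ∈ Finset.univ.erase i, if w j = z then 1 else 0 := by
    intro w
    rw [ofTuple_mult, Finset.add_sum_erase _ (fun j => if w j = z then 1 else 0) (Finset.mem_univ i)]
  have h2 : ∑ j ∈ Finset.univ.erase i, (if Function.update x i y j = z then 1 else 0)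
      = ∑ j ∈ Finset.univ.erase i, if x j = z then 1 else 0 :=
    Finset.sum_congr rfl fun j hj => by
      rw [Function.update_of_ne (Finset.ne_of_mem_erase hj)]
  have h3 : (ofTuple (n := 1) fun _ => y).mult z = if y = z then 1 else 0 := by
    rw [ofTuple_mult]
    simp
  simp only [jump, erase, add_mult, h3, h1 x, h1 (Function.update x i y), h2,
    Function.update_self, eq_comm (a := z)]
  split_ifs <;> omega

/-- Only one copy of `x i` is removed, so `x j` survives even if the two points coincide. Thus the
hypothesis on jump rates applies to every other coordinate. -/
lemma PointConfig.erase_ofTuple_add_mult_ne_zero {n : ℕ} (x : Fin n → S) (η : PointConfig S)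
    {i j : Fin n} (hij : j ≠ i) : ((ofTuple x + η).erase (x i)).mult (x j) ≠ 0 := by
  classical
  have h : (ofTuple x).mult (x j) = (if x i = x j then 1 else 0) +
      ∑ k ∈ Finset.univ.erase i, if x k = x j then 1 else 0 := by
    rw [ofTuple_mult,
      Finset.add_sum_erase _ (fun k => if x k = x j then 1 else 0) (Finset.mem_univ i)]
  have h1 : 1 ≤ ∑ k ∈ Finset.univ.erase i, if x k = x j then 1 else 0 := by
    refine le_trans (by simp) (Finset.single_le_sum (f := fun k => if x k = x j then 1 else 0)
      (fun _ _ => by positivity) (Finset.mem_erase.2 ⟨hij, Finset.mem_univ j⟩))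
  simp only [erase, add_mult, h, eq_comm (a := x j)]
  split_ifs <;> omega

end Jump

/-! ### Jumps do not hit null sets -/

section AbsoluteContinuity

variable {d : ℕ} {S : Set (EuclideanSpace ℝ (Fin d))}

lemma PointConfig.add_comm' (ξ η : PointConfig S) : ξ + η = η + ξ := by
  ext z
  simp [Nat.add_comm]

lemma measurable_outside (r : ℕ) : Measurable (outside (S := S) r) :=
  PointConfig.measurable_restrict (measurableSet_ballIn r).compl

lemma measurable_inside (r : ℕ) : Measurable (inside (S := S) r) :=
  PointConfig.measurable_restrict (measurableSet_ballIn r)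

lemma measurableSet_ae_ae_toMeasure (hS : IsClosed S) {T : Set ((PointConfig S × S) × S)}
    (hT : MeasurableSet T) (ρ : Measure S) [SFinite ρ] :
    MeasurableSet {ξ : PointConfig S | ∀ᵐ x ∂ξ.toMeasure, ∀ᵐ y ∂ρ, ((ξ, x), y) ∉ T} := by
  have := isSFiniteKernel_configKernel hS
  have hg : Measurable fun p : PointConfig S × S => ρ (Prod.mk p ⁻¹' T) :=
    measurable_measure_prodMk_left hT
  have hI : Measurable fun ξ : PointConfig S => ∫⁻ x, ρ (Prod.mk (ξ, x) ⁻¹' T) ∂configKernel S ξ :=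
    Measurable.lintegral_kernel_prod_right' hg
  convert hI (measurableSet_singleton 0) using 1
  ext ξ
  have hgξ : Measurable fun x => ρ (Prod.mk (ξ, x) ⁻¹' T) :=
    hg.comp (f := fun x => (ξ, x)) (by fun_prop)
  rw [Set.mem_preimage, Set.mem_singleton_iff, configKernel_apply, lintegral_eq_zero_iff hgξ]
  change (∀ᵐ x ∂ξ.toMeasure, ∀ᵐ y ∂ρ, ((ξ, x), y) ∉ T) ↔
    ∀ᵐ x ∂ξ.toMeasure, ρ (Prod.mk (ξ, x) ⁻¹' T) = 0
  simp_rw [measure_eq_zero_iff_ae_notMem, Set.mem_preimage]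

lemma measurable_exp_neg_hamiltonian {Φ : S → EReal} {Ψ : S → S → EReal} (hΦ : Measurable Φ)
    (hΨ : Measurable (Function.uncurry Ψ)) (r n : ℕ) :
    Measurable fun x : Fin n → S => EReal.exp (-hamiltonian Φ Ψ (ballIn S r) x) :=
  EReal.measurable_exp.comp (measurable_hamiltonian hΦ hΨ (measurableSet_ballIn r) n).neg

/-- The density `e^{-H}` vanishes exactly where `H = ⊤`, and the Poisson normalisation is nonzero.
-/
lemma ae_gibbsWeight_iff {Φ : S → EReal} {Ψ : S → S → EReal} (hΦ : Measurable Φ)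
    (hΨ : Measurable (Function.uncurry Ψ)) (r n : ℕ) {p : PointConfig S → Prop}
    (hp : MeasurableSet {ζ | p ζ}) :
    (∀ᵐ ζ ∂(gibbsWeight Φ Ψ r n), p ζ) ↔
      ∀ᵐ x ∂(Measure.pi fun _ : Fin n => (lebesgueOn S).restrict (ballIn S r)),
        hamiltonian Φ Ψ (ballIn S r) x ≠ ⊤ → p (PointConfig.ofTuple x) := by
  have hc : (ENNReal.ofReal (Real.exp (-(lebesgueOn S (ballIn S r)).toReal)) /
      (n.factorial : ℝ≥0∞)) ≠ 0 := by
    rw [ne_eq, ENNReal.div_eq_zero_iff, not_or]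
    exact ⟨by simp [Real.exp_pos], by simp⟩
  rw [gibbsWeight, Measure.ae_ennreal_smul_measure_iff hc,
    ae_map_iff PointConfig.measurable_ofTuple.aemeasurable hp,
    ae_withDensity_iff (measurable_exp_neg_hamiltonian hΦ hΨ r n)]
  refine eventually_congr (Eventually.of_forall fun x => ?_)
  simp

/-- Jumps inside `U_r`, under a measure whose conditional laws in `U_r` are comparable to the Gibbs
weight, do not hit null sets. -/
lemma ae_jump_notMem_of_condKernel (hS : IsClosed S) {Φ : S → EReal} {Ψ : S → S → EReal}
    (hΦ : Measurable Φ) (hΨ : Measurable (Function.uncurry Ψ))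
    (hΦbot : ∀ x, Φ x ≠ ⊥) (hΨbot : ∀ x y, Ψ x y ≠ ⊥) (hΨsymm : ∀ x y, Ψ x y = Ψ y x)
    (hΦtop : ∀ᵐ x ∂(lebesgueOn S), Φ x ≠ ⊤)
    (ν : PointConfig S → S → S → ℝ≥0)
    (hν : Measurable fun p : PointConfig S × S × S => ν p.1 p.2.1 p.2.2)
    (m : Measure (PointConfig S)) [IsFiniteMeasure m]
    (hνΨ : ∀ᵐ ξ ∂m, ∀ x : S, ξ.mult x ≠ 0 → ∀ᵐ y ∂(lebesgueOn S), ν ξ x y ≠ 0 →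
      ∀ z : S, (ξ.erase x).mult z ≠ 0 → Ψ y z ≠ ⊤)
    (r n : ℕ) (κ : Kernel (PointConfig S) (PointConfig S)) [IsMarkovKernel κ]
    (hκ : (m.map fun ξ => (outside r ξ, inside r ξ)).IsCondKernel κ)
    (hC : ∀ᵐ ξ ∂m, ∃ C : ℝ≥0, 0 < C ∧
          C⁻¹ • gibbsWeight Φ Ψ r n ≤ κ (outside r ξ) ∧
          κ (outside r ξ) ≤ C • gibbsWeight Φ Ψ r n)
    {A : Set (PointConfig S)} (hA : MeasurableSet A) (hmA : m A = 0) :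
    ∀ᵐ ξ ∂m, ∀ᵐ x ∂ξ.toMeasure, ∀ᵐ y ∂(lebesgueOn S),
      ((ξ, x), y) ∉ {p : (PointConfig S × S) × S | p.1.2 ∈ ballIn S r ∧ p.2 ∈ ballIn S r ∧
        ν p.1.1 p.1.2 p.2 ≠ 0 ∧ p.1.1.jump p.1.2 p.2 ∈ A} := by
  have := sigmaFinite_lebesgueOn hS
  have : SigmaFinite ((lebesgueOn S).restrict (ballIn S r)) := inferInstance
  set U := ballIn S r
  have hU : MeasurableSet U := measurableSet_ballIn r
  set T := {p : (PointConfig S × S) × S | p.1.2 ∈ U ∧ p.2 ∈ U ∧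
        ν p.1.1 p.1.2 p.2 ≠ 0 ∧ p.1.1.jump p.1.2 p.2 ∈ A}
  have hT : MeasurableSet T := by
    refine ((measurable_snd.comp measurable_fst) hU).inter ((measurable_snd hU).inter
      (MeasurableSet.inter ?_ (measurable_jump hS hA)))
    have h : Measurable fun p : (PointConfig S × S) × S => ν p.1.1 p.1.2 p.2 :=
      hν.comp (f := fun p : (PointConfig S × S) × S => (p.1.1, p.1.2, p.2)) (by fun_prop)
    exact (h (measurableSet_singleton 0)).compl
  obtain ⟨N, hNsub, hN, hmN⟩ := exists_measurable_superset_of_null hνΨ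
  have hQ : ∀ ξ ∉ N, ∀ x : S, ξ.mult x ≠ 0 → ∀ᵐ y ∂(lebesgueOn S), ν ξ x y ≠ 0 →
      ∀ z : S, (ξ.erase x).mult z ≠ 0 → Ψ y z ≠ ⊤ := fun ξ hξ => by
    by_contra h
    exact hξ (hNsub h)
  let G := {ξ : PointConfig S | ∀ᵐ x ∂ξ.toMeasure, ∀ᵐ y ∂(lebesgueOn S), ((ξ, x), y) ∉ T}
  have hG : MeasurableSet G := measurableSet_ae_ae_toMeasure hS hT _
  have hB : MeasurableSet (A ∪ N)ᶜ := (hA.union hN).compl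
  have hadd := PointConfig.measurable_add (S := S)
  have hΘ : Measurable fun ξ : PointConfig S => (outside r ξ, inside r ξ) :=
    (measurable_outside r).prodMk (measurable_inside r)
  have hsplit : ∀ ξ : PointConfig S, outside r ξ + inside r ξ = ξ := fun ξ =>
    ξ.restrict_compl_add_restrict _
  have hfst : (m.map fun ξ => (outside r ξ, inside r ξ)).fst = m.map (outside r) :=
    Measure.fst_map_prodMk (measurable_inside r)
  have hdis := hκ.disintegrate
  -- Disintegration: `ξ` is its outer part plus its inner part, and the inner part may be resampled
  -- from `κ`.
  have key : ∀ {H : Set (PointConfig S)}, MeasurableSet H →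
      ((∀ᵐ ξ ∂m, ξ ∈ H) ↔ ∀ᵐ ξ ∂m, ∀ᵐ ζ ∂κ (outside r ξ), outside r ξ + ζ ∈ H) := by
    intro H hH
    have hH' : MeasurableSet {p : PointConfig S × PointConfig S | p.1 + p.2 ∈ H} := hadd hH
    have h1 : (∀ᵐ ξ ∂m, ξ ∈ H) ↔
        ∀ᵐ p ∂(m.map fun ξ => (outside r ξ, inside r ξ)), p.1 + p.2 ∈ H := by
      rw [ae_map_iff hΘ.aemeasurable hH']
      simp_rw [hsplit]
    have h2 : MeasurableSet {η : PointConfig S | ∀ᵐ ζ ∂κ η, η + ζ ∈ H} :=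
      Kernel.measurable_kernel_prodMk_left (κ := κ) hH'.compl (measurableSet_singleton 0)
    rw [h1, ← hdis, Measure.ae_compProd_iff hH', hfst,
      ae_map_iff (measurable_outside r).aemeasurable h2]
  have hmB : ∀ᵐ ξ ∂m, ξ ∈ (A ∪ N)ᶜ := measure_eq_zero_iff_ae_notMem.1 (measure_union_null hmA hmN)
  refine (key hG).2 ?_
  filter_upwards [(key hB).1 hmB, hC] with ξ h ⟨C, hC0, hl, hu⟩
  set η := outside r ξ with hη
  have hηU : ∀ x ∈ U, η.mult x = 0 := fun x hx => by
    simp only [hη, outside, PointConfig.restrict]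
    exact Set.indicator_of_notMem (by simpa using hx) _
  have haddη : Measurable fun ζ : PointConfig S => η + ζ :=
    hadd.comp (measurable_const.prodMk measurable_id)
  -- The lower Gibbs bound carries null sets from `κ` to the Gibbs weight; the upper bound then
  -- carries the conclusion back to `κ`.
  have h' : ∀ᵐ ζ ∂(gibbsWeight Φ Ψ r n), η + ζ ∈ (A ∪ N)ᶜ := by
    have h1 : ∀ᵐ ζ ∂(C⁻¹ • gibbsWeight Φ Ψ r n), η + ζ ∈ (A ∪ N)ᶜ := ae_mono hl h
    rwa [Measure.ae_smul_measure_iff (inv_ne_zero hC0.ne')] at h1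
  refine ae_mono hu (Measure.ae_smul_measure ?_ C)
  rw [ae_gibbsWeight_iff hΦ hΨ r n (haddη hB)] at h'
  refine (ae_gibbsWeight_iff hΦ hΨ r n (haddη hG)).2 ?_
  have hmem : ∀ᵐ x ∂(Measure.pi fun _ : Fin n => (lebesgueOn S).restrict U), ∀ i, x i ∈ U :=
    ae_all_iff.2 fun i => (Measure.quasiMeasurePreserving_eval
      (μ := fun _ : Fin n => (lebesgueOn S).restrict U) i).ae (ae_restrict_mem hU)
  have hupd := ae_all_iff.2 fun i => ae_ae_update_of_ae_pi _ h' i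
  filter_upwards [hmem, h', hupd] with x hxU hxB hxu hH
  have hxN : η + PointConfig.ofTuple x ∉ N := fun hc => hxB hH (Or.inr hc)
  rw [PointConfig.add_comm'] at hxN ⊢
  refine (ae_toMeasure_iff hS _).2 fun w hw => ?_
  by_cases hwU : w ∈ U
  swap
  · exact Eventually.of_forall fun y hy => hwU hy.1
  have hw' : (PointConfig.ofTuple x).mult w ≠ 0 := by
    rwa [PointConfig.add_mult, hηU w hwU, add_zero] at hw
  obtain ⟨i, rfl⟩ := (PointConfig.ofTuple_mult_ne_zero x).1 hw'
  filter_upwards [(ae_restrict_iff' hU).1 (hxu i), hΦtop, hQ _ hxN _ hw] with y hy hyΦ hyΨ hyT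
  obtain ⟨-, hyU, hyν, hyA⟩ := hyT
  refine hy hyU ?_ (Or.inl ?_)
  · have hU' : ∀ j, Function.update x i y j ∈ U := fun j => by
      by_cases hj : j = i
      · subst hj; simpa using hyU
      · simpa [hj] using hxU j
    -- The updated tuple has finite energy: terms without `y` are terms of the old energy, `Φ y` is
    -- finite for almost every `y`, and `Ψ y (x j)` is finite because the jump rate is nonzero.
    rw [ne_eq, hamiltonian_eq_top_iff hΦbot hΨbot hxU, not_or] at hH
    rw [ne_eq, hamiltonian_eq_top_iff hΦbot hΨbot hU', not_or]
    have hyx : ∀ j, j ≠ i → Ψ y (x j) ≠ ⊤ := fun j hj =>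
      hyΨ hyν _ (PointConfig.erase_ofTuple_add_mult_ne_zero x η hj)
    constructor
    · rintro ⟨j, hj⟩
      by_cases hji : j = i
      · subst hji
        exact hyΦ (by simpa using hj)
      · exact hH.1 ⟨j, by simpa [hji] using hj⟩
    · rintro ⟨j, k, hjk, hjk'⟩
      by_cases hji : j = i
      · subst hji
        exact hyx k hjk.ne' (by simpa [hjk.ne'] using hjk')
      · by_cases hki : k = i
        · subst hki
          exact hyx j hji (by simpa [hji, hΨsymm] using hjk')
        · exact hH.2 ⟨j, k, hjk, by simpa [hji, hki] using hjk'⟩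
  · rw [PointConfig.add_comm', ← PointConfig.jump_ofTuple_add]
    exact hyA

/-- Under a quasi-Gibbs measure, jumps do not hit null sets. -/
lemma ae_jump_notMem_of_isQuasiGibbs (hS : IsClosed S) {Φ : S → EReal} {Ψ : S → S → EReal}
    (hΦ : Measurable Φ) (hΨ : Measurable (Function.uncurry Ψ))
    (hΦbot : ∀ x, Φ x ≠ ⊥) (hΨbot : ∀ x y, Ψ x y ≠ ⊥) (hΨsymm : ∀ x y, Ψ x y = Ψ y x)
    (hΦtop : ∀ᵐ x ∂(lebesgueOn S), Φ x ≠ ⊤)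
    (ν : PointConfig S → S → S → ℝ≥0)
    (hν : Measurable fun p : PointConfig S × S × S => ν p.1 p.2.1 p.2.2)
    (μ : Measure (PointConfig S)) [IsFiniteMeasure μ]
    (hνΨ : ∀ᵐ ξ ∂μ, ∀ x : S, ξ.mult x ≠ 0 → ∀ᵐ y ∂(lebesgueOn S), ν ξ x y ≠ 0 →
      ∀ z : S, (ξ.erase x).mult z ≠ 0 → Ψ y z ≠ ⊤)
    (hμ : IsQuasiGibbs Φ Ψ μ) {A : Set (PointConfig S)} (hA : MeasurableSet A) (hμA : μ A = 0) :
    ∀ᵐ ξ ∂μ, ∀ᵐ x ∂ξ.toMeasure, ∀ᵐ y ∂(lebesgueOn S), ν ξ x y ≠ 0 → ξ.jump x y ∉ A := by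
  obtain ⟨b, hb, -, m, hm⟩ := hμ
  have hr : ∀ r : ℕ, ∀ᵐ ξ ∂μ, ∀ᵐ x ∂ξ.toMeasure, ∀ᵐ y ∂(lebesgueOn S),
      ((ξ, x), y) ∉ {p : (PointConfig S × S) × S | p.1.2 ∈ ballIn S (b r) ∧ p.2 ∈ ballIn S (b r) ∧
        ν p.1.1 p.1.2 p.2 ≠ 0 ∧ p.1.1.jump p.1.2 p.2 ∈ A} := by
    intro r
    rw [← Measure.restrict_univ (μ := μ), ← iUnion_configsWith hS (b r), ae_restrict_iUnion_iff]
    intro n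
    obtain ⟨hfin, hmono, hlim, hcond⟩ := hm r n
    obtain ⟨hle, hnull⟩ := null_of_monotone_vague_limit hS (m r n) hmono
      (μ.restrict (configsWith S (b r) n)) hlim
    refine hnull _ fun k => ?_
    have hkμ : m r n k ≤ μ := (hle k).trans Measure.restrict_le_self
    obtain ⟨κ, hκM, hκ, hC⟩ := hcond k
    exact ae_jump_notMem_of_condKernel hS hΦ hΨ hΦbot hΨbot hΨsymm hΦtop ν hν (m r n k)
      (ae_mono hkμ hνΨ) (b r) n κ hκ hC hA (hkμ.absolutelyContinuous hμA)
  filter_upwards [ae_all_iff.2 hr] with ξ h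
  filter_upwards [ae_all_iff.2 h] with x h
  filter_upwards [ae_all_iff.2 h] with y h hyν hyA
  obtain ⟨r, hx⟩ := exists_mem_ballIn x
  obtain ⟨s, hy⟩ := exists_mem_ballIn y
  -- A single ball must contain both endpoints of the jump; strict monotonicity of `b` gives `max r
  -- s ≤ b (max r s)`.
  exact h (max r s) ⟨ballIn_mono ((le_max_left r s).trans (hb.le_apply)) hx,
    ballIn_mono ((le_max_right r s).trans (hb.le_apply)) hy, hyν, hyA⟩

end AbsoluteContinuity

/-! ### The energy as one integral, and its lower semicontinuity -/

section Form

variable {d : ℕ} {S : Set (EuclideanSpace ℝ (Fin d))}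

lemma IsLocalFun.measurable {f : PointConfig S → ℝ} (hf : IsLocalFun f) : Measurable f := by
  obtain ⟨r, hr⟩ := hf
  exact hr.mono (measurable_inside r).comap_le le_rfl

lemma measurable_jumpDiff (hS : IsClosed S) {f : PointConfig S → ℝ} (hf : Measurable f) :
    Measurable fun p : (PointConfig S × S) × S => jumpDiff f p.1.1 p.1.2 p.2 :=
  (hf.comp (measurable_jump hS)).sub (hf.comp (by fun_prop))

lemma jumpDiff_sub (f g : PointConfig S → ℝ) (ξ : PointConfig S) (x y : S) :
    jumpDiff (f - g) ξ x y = jumpDiff f ξ x y - jumpDiff g ξ x y := by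
  simp only [jumpDiff, Pi.sub_apply]
  ring

/-- The measure `μ(dξ) ξ(dx) dy`. -/
def jumpMeasure (μ : Measure (PointConfig S)) : Measure ((PointConfig S × S) × S) :=
  (μ ⊗ₘ configKernel S).prod (lebesgueOn S)

/-- The integrand of the energy. -/
def jumpDensity (ν : PointConfig S → S → S → ℝ≥0) (f : PointConfig S → ℝ)
    (p : (PointConfig S × S) × S) : ℝ≥0∞ :=
  ENNReal.ofReal (jumpDiff f p.1.1 p.1.2 p.2 ^ 2) * (ν p.1.1 p.1.2 p.2 : ℝ≥0∞)

variable {ν : PointConfig S → S → S → ℝ≥0} {μ : Measure (PointConfig S)} [SFinite μ]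
  {f g : PointConfig S → ℝ}

lemma measurable_rate (hν : Measurable fun p : PointConfig S × S × S => ν p.1 p.2.1 p.2.2) :
    Measurable fun p : (PointConfig S × S) × S => ν p.1.1 p.1.2 p.2 :=
  hν.comp (f := fun p : (PointConfig S × S) × S => (p.1.1, p.1.2, p.2)) (by fun_prop)

lemma measurable_jumpDensity (hS : IsClosed S)
    (hν : Measurable fun p : PointConfig S × S × S => ν p.1 p.2.1 p.2.2) (hf : Measurable f) :
    Measurable (jumpDensity ν f) :=
  (ENNReal.measurable_ofReal.comp ((measurable_jumpDiff hS hf).pow_const 2)).mul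
    (measurable_rate hν).coe_nnreal_ennreal

lemma jumpEnergy_eq_lintegral (hS : IsClosed S)
    (hν : Measurable fun p : PointConfig S × S × S => ν p.1 p.2.1 p.2.2) (hf : Measurable f) :
    jumpEnergy ν μ f = 1 / 2 * ∫⁻ p, jumpDensity ν f p ∂(jumpMeasure μ) := by
  have := sigmaFinite_lebesgueOn hS
  have := isSFiniteKernel_configKernel hS
  have hm := measurable_jumpDensity hS hν hf
  have h1 : Measurable fun q : PointConfig S × S => ∫⁻ y, jumpDensity ν f (q, y) ∂(lebesgueOn S) :=
    hm.lintegral_prod_right'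
  have h2 : Measurable fun ξ : PointConfig S =>
      ∫⁻ x, ∫⁻ y, jumpDensity ν f ((ξ, x), y) ∂(lebesgueOn S) ∂configKernel S ξ :=
    Measurable.lintegral_kernel_prod_right' h1
  rw [jumpMeasure, lintegral_prod _ hm.aemeasurable, Measure.lintegral_compProd h1,
    ← lintegral_const_mul _ h2]
  rfl

/-- Finite energy makes the integrand integrable on the product space, so Fubini applies to the
iterated Bochner integrals, which would otherwise take default values. -/
lemma jumpForm_eq_toReal (hS : IsClosed S)
    (hν : Measurable fun p : PointConfig S × S × S => ν p.1 p.2.1 p.2.2) (hf : Measurable f)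
    (hfin : jumpEnergy ν μ f < ∞) : jumpForm ν μ f f = (jumpEnergy ν μ f).toReal := by
  have := sigmaFinite_lebesgueOn hS
  have := isSFiniteKernel_configKernel hS
  set h : (PointConfig S × S) × S → ℝ := fun p =>
    jumpDiff f p.1.1 p.1.2 p.2 * jumpDiff f p.1.1 p.1.2 p.2 * (ν p.1.1 p.1.2 p.2 : ℝ) with hh
  have hmeas : Measurable h :=
    ((measurable_jumpDiff hS hf).mul (measurable_jumpDiff hS hf)).mul
      (measurable_rate hν).coe_nnreal_real
  have hnn : ∀ p, 0 ≤ h p := fun p => mul_nonneg (mul_self_nonneg _) (NNReal.coe_nonneg _)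
  have hdens : ∀ p, ENNReal.ofReal (h p) = jumpDensity ν f p := fun p => by
    rw [hh, jumpDensity, ENNReal.ofReal_mul (mul_self_nonneg _), pow_two,
      ENNReal.ofReal_coe_nnreal]
  rw [jumpEnergy_eq_lintegral hS hν hf] at hfin ⊢
  have hlt : ∫⁻ p, jumpDensity ν f p ∂(jumpMeasure μ) < ∞ := by
    by_contra hc
    rw [not_lt_top_iff] at hc
    rw [hc] at hfin
    simp [ENNReal.mul_top] at hfin
  have hint : Integrable h ((μ ⊗ₘ configKernel S).prod (lebesgueOn S)) := by
    refine ⟨hmeas.aestronglyMeasurable, ?_⟩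
    rw [hasFiniteIntegral_iff_ofReal (Eventually.of_forall hnn)]
    simp_rw [hdens]
    exact hlt
  have hint1 := hint.integral_prod_left
  have hI : ∫ p, h p ∂(jumpMeasure μ) =
      ∫ ξ, ∫ x, ∫ y, h ((ξ, x), y) ∂(lebesgueOn S) ∂configKernel S ξ ∂μ := by
    rw [jumpMeasure, integral_prod _ hint, Measure.integral_compProd hint1]
  have hJ : jumpForm ν μ f f = 1 / 2 * ∫ p, h p ∂(jumpMeasure μ) := by
    rw [hI, ← integral_const_mul]
    rfl
  rw [hJ, integral_eq_lintegral_of_nonneg_ae (Eventually.of_forall hnn)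
    hmeas.aestronglyMeasurable, ENNReal.toReal_mul]
  simp [hdens]

/-- Pointwise, `(a - b)² ≤ 2 (a² + b²)`. -/
lemma jumpEnergy_sub_lt_top (hS : IsClosed S)
    (hν : Measurable fun p : PointConfig S × S × S => ν p.1 p.2.1 p.2.2)
    (hf : Measurable f) (hg : Measurable g)
    (hf' : jumpEnergy ν μ f < ∞) (hg' : jumpEnergy ν μ g < ∞) :
    jumpEnergy ν μ (f - g) < ∞ := by
  have hle : ∀ p, jumpDensity ν (f - g) p ≤ 2 * (jumpDensity ν f p + jumpDensity ν g p) := by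
    intro p
    simp only [jumpDensity, jumpDiff_sub]
    rw [← add_mul, ← mul_assoc, ← ENNReal.ofReal_add (sq_nonneg _) (sq_nonneg _),
      show (2 : ℝ≥0∞) = ENNReal.ofReal 2 by simp, ← ENNReal.ofReal_mul (by norm_num)]
    gcongr
    nlinarith [sq_nonneg (jumpDiff f p.1.1 p.1.2 p.2 + jumpDiff g p.1.1 p.1.2 p.2)]
  have hmf := measurable_jumpDensity hS hν hf
  have hmg := measurable_jumpDensity hS hν hg
  calc jumpEnergy ν μ (f - g)
      = 1 / 2 * ∫⁻ p, jumpDensity ν (f - g) p ∂(jumpMeasure μ) :=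
        jumpEnergy_eq_lintegral hS hν (hf.sub hg)
    _ ≤ 1 / 2 * ∫⁻ p, 2 * (jumpDensity ν f p + jumpDensity ν g p) ∂(jumpMeasure μ) := by
        gcongr with p
        exact hle p
    _ = 2 * (jumpEnergy ν μ f + jumpEnergy ν μ g) := by
        rw [lintegral_const_mul _ (by exact hmf.add hmg), lintegral_add_left hmf,
          jumpEnergy_eq_lintegral hS hν hf, jumpEnergy_eq_lintegral hS hν hg]
        ring
    _ < ∞ := ENNReal.mul_lt_top (by simp) (ENNReal.add_lt_top.2 ⟨hf', hg'⟩)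

/-- Lower semicontinuity of the energy along differences with a sequence that tends to `0` almost
surely, provided that jumps do not hit null sets. -/
lemma jumpEnergy_le_liminf_sub (hS : IsClosed S)
    (hν : Measurable fun p : PointConfig S × S × S => ν p.1 p.2.1 p.2.2)
    (hac : ∀ A : Set (PointConfig S), MeasurableSet A → μ A = 0 →
      ∀ᵐ ξ ∂μ, ∀ᵐ x ∂ξ.toMeasure, ∀ᵐ y ∂(lebesgueOn S), ν ξ x y ≠ 0 → ξ.jump x y ∉ A)
    (hf : Measurable f) {u : ℕ → PointConfig S → ℝ} (hu : ∀ j, Measurable (u j))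
    (hlim : ∀ᵐ ξ ∂μ, Tendsto (fun j => u j ξ) atTop (𝓝 0)) :
    jumpEnergy ν μ f ≤ liminf (fun j => jumpEnergy ν μ (f - u j)) atTop := by
  have := sigmaFinite_lebesgueOn hS
  have := isSFiniteKernel_configKernel hS
  obtain ⟨A, hAsub, hA, hμA⟩ := exists_measurable_superset_of_null hlim
  have hAlim : ∀ ξ ∉ A, Tendsto (fun j => u j ξ) atTop (𝓝 0) := fun ξ hξ => by
    by_contra h
    exact hξ (hAsub h)
  have hB : MeasurableSet {p : (PointConfig S × S) × S |
      ν p.1.1 p.1.2 p.2 ≠ 0 → p.1.1 ∉ A ∧ p.1.1.jump p.1.2 p.2 ∉ A} := by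
    have h1 : MeasurableSet {p : (PointConfig S × S) × S | ν p.1.1 p.1.2 p.2 ≠ 0} :=
      ((measurable_rate hν) (measurableSet_singleton 0)).compl
    have h2 : MeasurableSet {p : (PointConfig S × S) × S | p.1.1 ∈ A} :=
      (measurable_fst.comp measurable_fst) hA
    exact h1.imp (h2.compl.inter (measurable_jump hS hA).compl)
  have hae : ∀ᵐ p ∂(jumpMeasure μ),
      ν p.1.1 p.1.2 p.2 ≠ 0 → p.1.1 ∉ A ∧ p.1.1.jump p.1.2 p.2 ∉ A := by
    rw [jumpMeasure, Measure.ae_prod_iff_ae_ae hB]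
    refine Measure.ae_compProd_of_ae_ae ?_ ?_
    · exact (measurable_measure_prodMk_left (ν := lebesgueOn S) hB.compl)
        (measurableSet_singleton 0)
    · filter_upwards [hac A hA hμA, measure_eq_zero_iff_ae_notMem.1 hμA] with ξ h hξ
      filter_upwards [h] with x h
      filter_upwards [h] with y h hy
      exact ⟨hξ, h hy⟩
  have hdens : ∀ᵐ p ∂(jumpMeasure μ),
      jumpDensity ν f p = liminf (fun j => jumpDensity ν (f - u j) p) atTop := by
    filter_upwards [hae] with p hp
    refine (Tendsto.liminf_eq ?_).symm
    by_cases h0 : ν p.1.1 p.1.2 p.2 = 0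
    · simp [jumpDensity, h0]
    · obtain ⟨h1, h2⟩ := hp h0
      refine ENNReal.Tendsto.mul_const ?_ (Or.inr ENNReal.coe_ne_top)
      -- Both endpoints of the jump avoid `A`, so the increment of `u j` tends to `0`.
      refine (ENNReal.continuous_ofReal.tendsto _).comp (Tendsto.pow ?_ 2)
      simp_rw [jumpDiff_sub]
      simpa [jumpDiff] using ((hAlim _ h2).sub (hAlim _ h1)).const_sub (jumpDiff f p.1.1 p.1.2 p.2)
  simp_rw [jumpEnergy_eq_lintegral hS hν hf,
    fun j => jumpEnergy_eq_lintegral (μ := μ) hS hν (hf.sub (hu j))]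
  rw [ENNReal.liminf_const_mul_of_ne_top (by simp)]
  gcongr
  rw [lintegral_congr_ae hdens]
  exact lintegral_liminf_le fun j => measurable_jumpDensity hS hν (hf.sub (hu j))

end Form

end

theorem theorem2 {d : ℕ} (S : Set (EuclideanSpace ℝ (Fin d))) (hS : IsClosed S)
    (hS0 : (0 : EuclideanSpace ℝ (Fin d)) ∈ S) (hSint : closure (interior S) = S)
    -- the potentials, with values in `ℝ ∪ {∞}`
    (Φ : S → EReal) (Ψ : S → S → EReal)
    (hΦ : Measurable Φ) (hΨ : Measurable (Function.uncurry Ψ))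
    (hΦbot : ∀ x, Φ x ≠ ⊥) (hΨbot : ∀ x y, Ψ x y ≠ ⊥)
    (hΨsymm : ∀ x y, Ψ x y = Ψ y x)
    (hΦtop : ∀ᵐ x ∂(lebesgueOn S), Φ x ≠ ⊤)
    -- the jump rate
    (ν : PointConfig S → S → S → ℝ≥0)
    (hν : Measurable fun p : PointConfig S × S × S => ν p.1 p.2.1 p.2.2)
    (hνint : ∀ (ξ : PointConfig S) (x : S), ξ.mult x ≠ 0 →
      ∫⁻ y, ENNReal.ofReal
        (min 1 (‖(y : EuclideanSpace ℝ (Fin d)) - (x : EuclideanSpace ℝ (Fin d))‖ ^ 2)) *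
          (ν ξ x y : ℝ≥0∞) ∂(lebesgueOn S) < ∞)
    (μ : Measure (PointConfig S)) [IsProbabilityMeasure μ]
    -- almost surely, no jumps to places of infinite interaction with the other particles
    (hνΨ : ∀ᵐ ξ ∂μ, ∀ x : S, ξ.mult x ≠ 0 → ∀ᵐ y ∂(lebesgueOn S), ν ξ x y ≠ 0 →
      ∀ z : S, (ξ.erase x).mult z ≠ 0 → Ψ y z ≠ ⊤)
    (hA3 : IsQuasiGibbs Φ Ψ μ)
    (hA4Φ : ComparableToUSC Φ) (hA4Ψ : ComparableToUSC (Function.uncurry Ψ)) :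
    IsClosableForm μ (jumpDomain ν μ) (jumpForm ν μ) := by
  have hac := fun A (hA : MeasurableSet A) (hμA : μ A = 0) =>
    ae_jump_notMem_of_isQuasiGibbs hS hΦ hΨ hΦbot hΨbot hΨsymm hΦtop ν hν μ hνΨ hA3 hA hμA
  intro f hf hcauchy hL2
  have hmeas : ∀ n, Measurable (f n) := fun n => (hf n).1.1.measurable
  have hfin : ∀ n, jumpEnergy ν μ (f n) < ∞ := fun n => (hf n).2.2
  have hsub : ∀ p q, jumpEnergy ν μ (f p - f q) < ∞ := fun p q =>
    jumpEnergy_sub_lt_top hS hν (hmeas p) (hmeas q) (hfin p) (hfin q)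
  have hE : Tendsto (fun p : ℕ × ℕ => jumpEnergy ν μ (f p.1 - f p.2)) atTop (𝓝 0) := by
    have hne : ∀ p : ℕ × ℕ, jumpEnergy ν μ (f p.1 - f p.2) ≠ ∞ := fun p => (hsub p.1 p.2).ne
    refine (ENNReal.tendsto_toReal_iff hne ENNReal.zero_ne_top).1 ?_
    refine hcauchy.congr fun p => ?_
    exact jumpForm_eq_toReal hS hν ((hmeas p.1).sub (hmeas p.2)) (hsub p.1 p.2)
  have hmeasure : TendstoInMeasure μ f atTop 0 :=
    tendstoInMeasure_of_tendsto_eLpNorm (p := 2) (by simp)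
      (fun n => (hmeas n).aestronglyMeasurable) aestronglyMeasurable_zero (hL2.congr fun n => by rw [sub_zero])
  obtain ⟨q, hq, hqlim⟩ := hmeasure.exists_seq_tendsto_ae
  have hzero : Tendsto (fun n => jumpEnergy ν μ (f n)) atTop (𝓝 0) := by
    rw [ENNReal.tendsto_nhds_zero]
    intro ε hε
    -- For `p` and `q j` beyond `a` the energy of the difference is at most `ε`, and the liminf over
    -- `j` inherits this bound.
    obtain ⟨a, ha⟩ := eventually_atTop_prod_self'.1 (ENNReal.tendsto_nhds_zero.1 hE ε hε)
    filter_upwards [eventually_ge_atTop a] with p hp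
    refine (jumpEnergy_le_liminf_sub hS hν hac (hmeas p) (fun j => hmeas (q j)) hqlim).trans ?_
    refine liminf_le_of_frequently_le' (Eventually.frequently ?_)
    filter_upwards [hq.tendsto_atTop.eventually_ge_atTop a] with j hj
    exact ha p hp (q j) hj
  have hreal := (ENNReal.tendsto_toReal_iff (fun n => (hfin n).ne) ENNReal.zero_ne_top).2 hzero
  exact hreal.congr fun n => (jumpForm_eq_toReal hS hν (hmeas n) (hfin n)).symm
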